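/- Let $\mathrm{PSL}(2,\mathbb{C})$ act on the Riemann sphere $\widehat{\mathbb{C}}=\mathbb{C}\cup\{\infty\}$ by linear fractional transformations $z\mapsto\frac{az+b}{cz+d}$. For a subset $\alpha\subseteq\widehat{\mathbb{C}}$ let $\mathcal{A}_\alpha=\{f\in\mathrm{PSL}(2,\mathbb{C}) : f(\alpha)=\alpha\}$ be the group of all linear fractional transformations that leave $\alpha$ invariant as a set. Then for every finite non-trivial subgroup $G$ of $\mathrm{PSL}(2,\mathbb{C})$ there exists a finite subset $\alpha=\{z_1,z_2,\dots,z_n\}\subseteq\widehat{\mathbb{C}}$ such that $\mathcal{A}_\alpha\cong G$. -/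

import Mathlib

open scoped Pointwise

/-- The Riemann sphere `ℂ ∪ {∞}`. -/
abbrev RiemannSphere : Type := OnePoint ℂ

/-- The group `PSL(2, ℂ) = SL(2, ℂ) / {±1}` of linear fractional transformations. -/
abbrev LinearFractional : Type := Matrix.ProjectiveSpecialLinearGroup (Fin 2) ℂ

/-- `PSL(2, ℂ)` acts on the Riemann sphere, identified with the projective line `ℙ¹(ℂ)`
through `z ↦ [z : 1]`, `∞ ↦ [1 : 0]`, by linear fractional transformations. The lemmas
`LinearFractional.mk_smul_coe` and `LinearFractional.mk_smul_infty` give the formulas. -/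
noncomputable instance LinearFractional.instMulAction :
    MulAction LinearFractional RiemannSphere :=
  (OnePoint.equivProjectivization ℂ).mulAction LinearFractional

theorem LinearFractional.mk_smul (g : Matrix.SpecialLinearGroup (Fin 2) ℂ)
    (x : RiemannSphere) :
    (QuotientGroup.mk g : LinearFractional) • x =
      (g : Matrix.GeneralLinearGroup (Fin 2) ℂ) • x :=
  rfl

/-- The class of `!![a, b; c, d]` sends `z` to `(a z + b) / (c z + d)`. -/
theorem LinearFractional.mk_smul_coe (g : Matrix.SpecialLinearGroup (Fin 2) ℂ) (z : ℂ) :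
    (QuotientGroup.mk g : LinearFractional) • (z : RiemannSphere) =
      if g 1 0 * z + g 1 1 = 0 then OnePoint.infty
      else (((g 0 0 * z + g 0 1) / (g 1 0 * z + g 1 1) : ℂ) : RiemannSphere) := by
  rw [LinearFractional.mk_smul, OnePoint.smul_some_eq_ite]
  rfl

/-- The class of `!![a, b; c, d]` sends `∞` to `a / c`. -/
theorem LinearFractional.mk_smul_infty (g : Matrix.SpecialLinearGroup (Fin 2) ℂ) :
    (QuotientGroup.mk g : LinearFractional) • (OnePoint.infty : RiemannSphere) =
      if g 1 0 = 0 then OnePoint.infty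
      else ((g 0 0 / g 1 0 : ℂ) : RiemannSphere) := by
  rw [LinearFractional.mk_smul, OnePoint.smul_infty_eq_ite]
  rfl

/-- `A_α`: the group of all linear fractional transformations `f` with `f(α) = α`. -/
noncomputable def stabilizerGroup (α : Set RiemannSphere) : Subgroup LinearFractional :=
  MulAction.stabilizer LinearFractional α

theorem mem_stabilizerGroup {α : Set RiemannSphere} {f : LinearFractional} :
    f ∈ stabilizerGroup α ↔ (fun z : RiemannSphere => f • z) '' α = α :=
  Iff.rfl

/-! A linear fractional transformation is determined by three values. Take a finite `G`-invariant
set `A` with at least `|G| + 3` points and adjoin one orbit `B = Gx`. A map `f` preserving `A ∪ B`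
sends at most `|G|` points of `A` into `B`, hence at least three into `A`; only finitely many `f` do
this, and they depend on `A` alone. For generic `x`, none of them sends `x` into `A` or agrees at
`x` with an element of `G` other than itself. So `f • x ∈ B` forces `f ∈ G`: the stabilizer equals
`G`, not merely up to isomorphism. -/

/-- A linear fractional transformation with three distinct fixed points is the identity. -/
theorem LinearFractional.eq_one_of_three_fixed (f : LinearFractional) {x y z : RiemannSphere}
    (hxy : x ≠ y) (hxz : x ≠ z) (hyz : y ≠ z)
    (hx : f • x = x) (hy : f • y = y) (hz : f • z = z) : f = 1 := by
  obtain ⟨g, rfl⟩ := QuotientGroup.mk_surjective f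
  have hdet : g 0 0 * g 1 1 - g 0 1 * g 1 0 = 1 := by
    rw [← Matrix.det_fin_two]; exact g.2
  -- Finite fixed points are roots of a polynomial of degree at most two, so three of them kill it.
  -- Fixing `∞` kills the leading coefficient, after which two finite roots suffice.
  have hfin : ∀ w : ℂ, (QuotientGroup.mk g : LinearFractional) • (w : RiemannSphere) = w →
      g 1 0 * w ^ 2 + (g 1 1 - g 0 0) * w - g 0 1 = 0 := by
    intro w hw
    rw [LinearFractional.mk_smul_coe] at hw
    split_ifs at hw with h
    · exact absurd hw (OnePoint.infty_ne_coe w)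
    · have hw' := OnePoint.coe_injective hw
      rw [div_eq_iff h] at hw'
      linear_combination -hw'
  have hinf : (QuotientGroup.mk g : LinearFractional) • (OnePoint.infty : RiemannSphere) =
      OnePoint.infty → g 1 0 = 0 := by
    intro hw
    by_contra h
    rw [LinearFractional.mk_smul_infty, if_neg h] at hw
    exact OnePoint.coe_ne_infty _ hw
  have affine : ∀ u v : ℂ, u ≠ v → g 1 0 = 0 →
      g 1 0 * u ^ 2 + (g 1 1 - g 0 0) * u - g 0 1 = 0 →
      g 1 0 * v ^ 2 + (g 1 1 - g 0 0) * v - g 0 1 = 0 →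
      g 1 0 = 0 ∧ g 1 1 = g 0 0 ∧ g 0 1 = 0 := by
    intro u v huv hc hu hv
    rw [hc] at hu hv
    have had : g 1 1 - g 0 0 = 0 :=
      mul_right_cancel₀ (sub_ne_zero.2 huv) (by linear_combination hu - hv)
    refine ⟨hc, sub_eq_zero.1 had, ?_⟩
    linear_combination u * had - hu
  have key : g 1 0 = 0 ∧ g 1 1 = g 0 0 ∧ g 0 1 = 0 := by
    induction x using OnePoint.rec with
    | infty =>
      induction y using OnePoint.rec with
      | infty => exact absurd rfl hxy
      | coe v =>
        induction z using OnePoint.rec with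
        | infty => exact absurd rfl hxz
        | coe w =>
          exact affine v w (fun h => hyz (congrArg _ h)) (hinf hx) (hfin v hy) (hfin w hz)
    | coe u =>
      induction y using OnePoint.rec with
      | infty =>
        induction z using OnePoint.rec with
        | infty => exact absurd rfl hyz
        | coe w =>
          exact affine u w (fun h => hxz (congrArg _ h)) (hinf hy) (hfin u hx) (hfin w hz)
      | coe v =>
        have huv : u ≠ v := fun h => hxy (congrArg _ h)
        induction z using OnePoint.rec with
        | infty => exact affine u v huv (hinf hz) (hfin u hx) (hfin v hy)
        | coe w =>
          have huw : u ≠ w := fun h => hxz (congrArg _ h)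
          have hvw : v ≠ w := fun h => hyz (congrArg _ h)
          have h1 := hfin u hx
          have h2 := hfin v hy
          have h3 := hfin w hz
          -- Divided differences of the quadratic.
          have h12 : g 1 0 * (u + v) + (g 1 1 - g 0 0) = 0 :=
            mul_right_cancel₀ (sub_ne_zero.2 huv) (by linear_combination h1 - h2)
          have h13 : g 1 0 * (u + w) + (g 1 1 - g 0 0) = 0 :=
            mul_right_cancel₀ (sub_ne_zero.2 huw) (by linear_combination h1 - h3)
          have hc : g 1 0 = 0 :=
            mul_right_cancel₀ (sub_ne_zero.2 hvw) (by linear_combination h12 - h13)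
          exact affine u v huv hc h1 h2
  obtain ⟨hc, had, hb⟩ := key
  rw [QuotientGroup.eq_one_iff, Matrix.SpecialLinearGroup.mem_center_iff]
  refine ⟨g 0 0, ?_, ?_⟩
  · rw [hb, had] at hdet
    rw [Fintype.card_fin]
    linear_combination hdet
  · ext i j
    fin_cases i <;> fin_cases j <;> simp [hc, had, hb]

/-- A linear fractional transformation is determined by its values at three distinct points. -/
theorem LinearFractional.eq_of_three_smul_eq {f g : LinearFractional} {x y z : RiemannSphere}
    (hxy : x ≠ y) (hxz : x ≠ z) (hyz : y ≠ z)
    (hx : f • x = g • x) (hy : f • y = g • y) (hz : f • z = g • z) : f = g := by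
  refine (inv_mul_eq_one.1 (eq_one_of_three_fixed (g⁻¹ * f) hxy hxz hyz ?_ ?_ ?_)).symm <;>
    simpa only [mul_smul, inv_smul_eq_iff]

theorem LinearFractional.finite_setOf_smul_eq {f g : LinearFractional} (h : f ≠ g) :
    {x : RiemannSphere | f • x = g • x}.Finite := by
  classical
  by_contra hinf
  obtain ⟨t, ht, hcard⟩ := Set.Infinite.exists_subset_card_eq hinf 3
  obtain ⟨x, y, z, hxy, hxz, hyz, rfl⟩ := Finset.card_eq_three.1 hcard
  exact h (eq_of_three_smul_eq hxy hxz hyz (ht (by simp)) (ht (by simp)) (ht (by simp)))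

/-- The transformations carrying some three distinct points of `A` into `A`. -/
def LinearFractional.tripleCarriers (A : Set RiemannSphere) : Set LinearFractional :=
  {f | ∃ x ∈ A, ∃ y ∈ A, ∃ z ∈ A, x ≠ y ∧ x ≠ z ∧ y ≠ z ∧ f • x ∈ A ∧ f • y ∈ A ∧ f • z ∈ A}

/-- Each carrier is determined by a triple in `A` and its image triple, and there are finitely many
such pairs. -/
theorem LinearFractional.finite_tripleCarriers {A : Set RiemannSphere} (hA : A.Finite) :
    (tripleCarriers A).Finite := by
  have hT := (hA.prod (hA.prod hA)).prod (hA.prod (hA.prod hA))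
  refine (hT.biUnion (t := fun p => {f : LinearFractional | p.1.1 ≠ p.1.2.1 ∧
    p.1.1 ≠ p.1.2.2 ∧ p.1.2.1 ≠ p.1.2.2 ∧ f • p.1.1 = p.2.1 ∧ f • p.1.2.1 = p.2.2.1 ∧
    f • p.1.2.2 = p.2.2.2}) ?_).subset ?_
  · rintro ⟨⟨x, y, z⟩, x', y', z'⟩ -
    refine Set.Subsingleton.finite ?_
    rintro f ⟨hxy, hxz, hyz, h1, h2, h3⟩ g ⟨-, -, -, k1, k2, k3⟩
    exact eq_of_three_smul_eq hxy hxz hyz (h1.trans k1.symm) (h2.trans k2.symm)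
      (h3.trans k3.symm)
  · rintro f ⟨x, hx, y, hy, z, hz, hxy, hxz, hyz, h1, h2, h3⟩
    exact Set.mem_biUnion (x := ((x, y, z), (f • x, f • y, f • z)))
      ⟨⟨hx, hy, hz⟩, h1, h2, h3⟩ ⟨hxy, hxz, hyz, rfl, rfl, rfl⟩

/-- Adjoining few points to `A` leaves every stabilizing transformation a triple carrier of `A`. -/
theorem LinearFractional.mem_tripleCarriers_of_union {A B : Finset RiemannSphere}
    (hcard : B.card + 3 ≤ A.card) {f : LinearFractional}
    (hf : ∀ p ∈ A, f • p ∈ A ∨ f • p ∈ B) : f ∈ tripleCarriers (A : Set RiemannSphere) := by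
  classical
  have hB : (A.filter fun p => f • p ∈ B).card ≤ B.card :=
    Finset.card_le_card_of_injOn (f • ·) (fun p hp => (Finset.mem_filter.1 hp).2)
      (MulAction.injective f).injOn
  have hsplit := Finset.card_filter_add_card_filter_not (s := A) (fun p => f • p ∈ B)
  have h3 : 3 ≤ (A.filter fun p => ¬ f • p ∈ B).card := by omega
  obtain ⟨t, ht, htc⟩ := Finset.exists_subset_card_eq h3
  obtain ⟨x, y, z, hxy, hxz, hyz, rfl⟩ := Finset.card_eq_three.1 htc
  have hmem : ∀ p ∈ ({x, y, z} : Finset RiemannSphere), p ∈ A ∧ f • p ∈ A := fun p hp =>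
    have hp' := Finset.mem_filter.1 (ht hp)
    ⟨hp'.1, (hf p hp'.1).resolve_right hp'.2⟩
  obtain ⟨hx, hx'⟩ := hmem x (by simp)
  obtain ⟨hy, hy'⟩ := hmem y (by simp)
  obtain ⟨hz, hz'⟩ := hmem z (by simp)
  exact ⟨x, hx, y, hy, z, hz, hxy, hxz, hyz, hx', hy', hz'⟩

/-- Every finite subgroup is the full stabilizer of some finite set. -/
theorem LinearFractional.exists_finite_stabilizerGroup_eq (G : Subgroup LinearFractional)
    [Finite G] : ∃ α : Set RiemannSphere, α.Finite ∧ stabilizerGroup α = G := by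
  classical
  have := Fintype.ofFinite G
  have : Infinite RiemannSphere := inferInstanceAs (Infinite (Option ℂ))
  obtain ⟨S, hS⟩ := Infinite.exists_subset_card_eq RiemannSphere (Fintype.card G + 3)
  let A : Finset RiemannSphere := Finset.image₂ (fun (g : G) s => g • s) Finset.univ S
  have hSA : S ⊆ A := fun s hs =>
    Finset.mem_image₂.2 ⟨1, Finset.mem_univ _, s, hs, one_smul G s⟩
  have hAG : ∀ g ∈ G, ∀ p ∈ A, g • p ∈ A := by
    intro g hg p hp
    obtain ⟨h, -, s, hs, rfl⟩ := Finset.mem_image₂.1 hp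
    exact Finset.mem_image₂.2 ⟨⟨g, hg⟩ * h, Finset.mem_univ _, s, hs, mul_smul _ h s⟩
  have hF := finite_tripleCarriers A.finite_toSet
  have hbad₁ : (⋃ f ∈ tripleCarriers (A : Set RiemannSphere),
      {x : RiemannSphere | f • x ∈ A}).Finite :=
    hF.biUnion fun f _ => A.finite_toSet.preimage (MulAction.injective f).injOn
  have hbad₂ : (⋃ f ∈ tripleCarriers (A : Set RiemannSphere),
      ⋃ g : G, {x : RiemannSphere | f ≠ g ∧ f • x = (g : LinearFractional) • x}).Finite := by
    refine hF.biUnion fun f _ => Set.finite_iUnion fun g => ?_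
    by_cases h : f = g
    · simp [h]
    · exact (finite_setOf_smul_eq h).subset fun x hx => hx.2
  -- Both bad sets depend only on `A` and `G`, so `x` can be chosen after them.
  obtain ⟨x, hx⟩ := (hbad₁.union hbad₂).exists_notMem
  simp only [Set.mem_union, Set.mem_iUnion, Set.mem_ofPred_eq, not_or, not_exists, not_and] at hx
  obtain ⟨hxA, hxG⟩ := hx
  let B : Finset RiemannSphere := Finset.univ.image fun g : G => g • x
  have hBcard : B.card + 3 ≤ A.card := by
    have h1 : B.card ≤ Fintype.card G := Finset.card_image_le
    have h2 := Finset.card_le_card hSA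
    omega
  have hfin : (((A ∪ B : Finset RiemannSphere)) : Set RiemannSphere).Finite :=
    Finset.finite_toSet _
  refine ⟨_, hfin, ?_⟩
  ext f
  -- For a finite set, being mapped into itself already gives invariance.
  rw [stabilizerGroup, MulAction.mem_stabilizer_set' hfin]
  simp only [Finset.mem_coe, Finset.mem_union]
  constructor
  · intro hf
    have hfF := mem_tripleCarriers_of_union hBcard fun p hp => hf (Or.inl hp)
    have hxB : x ∈ B := Finset.mem_image.2 ⟨1, Finset.mem_univ _, one_smul G x⟩
    obtain ⟨g, -, hg⟩ := Finset.mem_image.1 ((hf (Or.inr hxB)).resolve_left (hxA f hfF))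
    by_contra hfG
    exact hxG f hfF g (fun h => hfG (h ▸ g.2)) hg.symm
  · rintro hf p (hp | hp)
    · exact Or.inl (hAG f hf p hp)
    · obtain ⟨g, -, rfl⟩ := Finset.mem_image.1 hp
      exact Or.inr (Finset.mem_image.2 ⟨⟨f, hf⟩ * g, Finset.mem_univ _, mul_smul _ g x⟩)

theorem mainTheorem1 (G : Subgroup LinearFractional) [Finite G] [Nontrivial G] :
    ∃ α : Set RiemannSphere, α.Finite ∧ Nonempty (stabilizerGroup α ≃* G) := by
  obtain ⟨α, hα, h⟩ := LinearFractional.exists_finite_stabilizerGroup_eq G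
  exact ⟨α, hα, ⟨MulEquiv.subgroupCongr h⟩⟩
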